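/- Let $G$ be a finite group of order $D$, let $\{|g\rangle^A\}_{g\in G}$ and $\{|g\rangle^B\}_{g\in G}$ be orthonormal bases of $\mathcal H_A=\mathcal H_B=\mathbb C^D$, let $(\lambda_g)_{g\in G}$ be a probability distribution on $G$, and let $\vartheta_{f,g}$ $(f,g\in G)$ be real numbers. Consider the $D$ (mutually orthogonal) group-shifted states $$|\psi_f\rangle^{AB}=\sum_{g\in G}\sqrt{\lambda_g}\,e^{i\vartheta_{f,g}}\,|g\rangle^A|fg\rangle^B,\qquad f\in G,$$ and suppose that they have full Schmidt rank $D$ and are not maximally entangled (a state of a $D\times D$ system is maximally entangled if all its Schmidt coefficients equal $1/D$; the Schmidt coefficients are the squared singular values of the matrix of amplitudes). Let $|\phi\rangle^{ab}$ be a normalized state of a second $D\times D$ system, and suppose that $\{|\psi_f\rangle\}_{f\in G}$ can be locally cloned with blank state $|\phi\rangle$ by a separable operation: there are finitely many operators $A_m$ on $\mathcal H_A\otimes\mathcal H_a$ and $B_m$ on $\mathcal H_B\otimes\mathcal H_b$ with $\sum_m A_m^\dagger A_m\otimes B_m^\dagger B_m=I\otimes I$ such that $\Lambda(\rho)=\sum_m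 (A_m\otimes B_m)\rho(A_m\otimes B_m)^\dagger$ satisfies $$\Lambda\big(|\psi_f\rangle\langle\psi_f|^{AB}\otimes|\phi\rangle\langle\phi|^{ab}\big)=|\psi_f\rangle\langle\psi_f|^{AB}\otimes|\psi_f\rangle\langle\psi_f|^{ab}\quad\text{for all } f\in G.$$ Put $q_r=\sum_{f\in G}\lambda_f\lambda_{fr}$ for $r\in G$, let $H(\{p_r\})=-\sum_r p_r\log_D p_r$ denote the Shannon entropy, and let the entropy of entanglement $E$ of a $D\times D$ state be the Shannon entropy of its Schmidt coefficients. Then $\{q_r\}_{r\in G}$ is a probability distribution and $$E(|\phi\rangle)\;\ge\; H(\{q_r\})\;>\;E(|\psi_f\rangle)\qquad\text{for all } f\in G.$$ In particular, the blank state is strictly more entangled than each of the states $|\psi_f\rangle$. -/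

import Mathlib

open scoped Matrix Kronecker

noncomputable section

namespace LocalCloning

/-- Kets of a bipartite system whose parts have computational bases indexed by `m` and `n`:
vectors of `ℂ^m ⊗ ℂ^n`, given by their amplitudes in the product basis. -/
abbrev BiKet (m n : Type*) := EuclideanSpace ℂ (m × n)

/-- The product ket `|u⟩ ⊗ |v⟩`. -/
def prodKet {m n : Type*} (u : EuclideanSpace ℂ m) (v : EuclideanSpace ℂ n) : BiKet m n :=
  WithLp.toLp 2 fun p => u p.1 * v p.2

/-- The ket `|χ⟩^{AB} ⊗ |η⟩^{ab}`, regarded as a ket shared between Alice, who holds `A` and `a`,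
and Bob, who holds `B` and `b`. -/
def jointKet {A B a b : Type*} (χ : BiKet A B) (η : BiKet a b) : BiKet (A × a) (B × b) :=
  WithLp.toLp 2 fun p => χ (p.1.1, p.2.1) * η (p.1.2, p.2.2)

/-- The rank-one operator `|χ⟩⟨χ|`. -/
def proj {m : Type*} (χ : EuclideanSpace ℂ m) : Matrix m m ℂ :=
  Matrix.of fun i j => χ i * star (χ j)

/-- Separable operations on a bipartite system: finitely many product Kraus operators that satisfy
the closure condition. -/
def IsSeparableOperation {m n : Type*} [Fintype m] [Fintype n] [DecidableEq m] [DecidableEq n]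
    (Λ : Matrix (m × n) (m × n) ℂ → Matrix (m × n) (m × n) ℂ) : Prop :=
  ∃ (M : ℕ) (K : Fin M → Matrix m m ℂ) (L : Fin M → Matrix n n ℂ),
    (∑ k, ((K k)ᴴ * K k) ⊗ₖ ((L k)ᴴ * L k) =
      (1 : Matrix m m ℂ) ⊗ₖ (1 : Matrix n n ℂ)) ∧
    ∀ ρ, Λ ρ = ∑ k, (K k ⊗ₖ L k) * ρ * (K k ⊗ₖ L k)ᴴ

/-- The family `ψ` can be locally cloned with blank state `φ`: one separable operation, with
respect to the cut between Alice and Bob, maps `ψ_i ⊗ φ` to `ψ_i ⊗ ψ_i` for every `i`. -/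
def LocallyCloneable {D : ℕ} {I : Type*} (ψ : I → BiKet (Fin D) (Fin D))
    (φ : BiKet (Fin D) (Fin D)) : Prop :=
  ∃ Λ : Matrix ((Fin D × Fin D) × (Fin D × Fin D)) ((Fin D × Fin D) × (Fin D × Fin D)) ℂ →
      Matrix ((Fin D × Fin D) × (Fin D × Fin D)) ((Fin D × Fin D) × (Fin D × Fin D)) ℂ,
    IsSeparableOperation Λ ∧
      ∀ i, Λ (proj (jointKet (ψ i) φ)) = proj (jointKet (ψ i) (ψ i))

/-- The matrix of amplitudes of a bipartite ket. -/
def coeffMatrix {m n : Type*} (χ : BiKet m n) : Matrix m n ℂ :=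
  Matrix.of fun i j => χ (i, j)

/-- The Schmidt coefficients of a `D × D` ket: the squared singular values of its matrix of
amplitudes, that is, the eigenvalues (with multiplicity) of `χ χ†`. They sum to one when the ket
is normalized. -/
def schmidtCoeff {D : ℕ} (χ : BiKet (Fin D) (Fin D)) : Fin D → ℝ :=
  (Matrix.isHermitian_mul_conjTranspose_self (coeffMatrix χ)).eigenvalues

/-- The number of nonzero Schmidt coefficients. -/
def schmidtRank {D : ℕ} (χ : BiKet (Fin D) (Fin D)) : ℕ :=
  Nat.card {r : Fin D // schmidtCoeff χ r ≠ 0}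

/-- All `D` Schmidt coefficients are equal to `1 / D`. -/
def IsMaximallyEntangled {D : ℕ} (χ : BiKet (Fin D) (Fin D)) : Prop :=
  ∀ r, schmidtCoeff χ r = 1 / (D : ℝ)

/-- Shannon entropy with logarithms to base `D` (and `0 log 0 = 0`). -/
def shannonEntropy (D : ℕ) {I : Type*} [Fintype I] (p : I → ℝ) : ℝ :=
  -∑ r, p r * Real.logb D (p r)

/-- Entropy of entanglement of a `D × D` ket, normalized by taking logarithms to base `D`. -/
def entanglementEntropy {D : ℕ} (χ : BiKet (Fin D) (Fin D)) : ℝ :=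
  shannonEntropy D (schmidtCoeff χ)

/-- The group-shifted kets
`|ψ_f⟩ = ∑ g, √(lam g) * exp (i θ_{f,g}) |g⟩^A |f g⟩^B`, where `|g⟩^A = a g` and `|g⟩^B = b g`
are orthonormal bases of Alice's and Bob's spaces labelled by the elements of the group. -/
def groupShifted {D : ℕ} {G : Type*} [Group G] [Fintype G]
    (a b : OrthonormalBasis G ℂ (EuclideanSpace ℂ (Fin D)))
    (lam : G → ℝ) (θ : G → G → ℝ) (f : G) : BiKet (Fin D) (Fin D) :=
  ∑ g, ((Real.sqrt (lam g) : ℂ) * Complex.exp (Complex.I * (θ f g : ℂ))) •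
    prodKet (a g) (b (f * g))

/-- The distribution `q_r = ∑ f, λ_f λ_{f r}`. -/
def shiftOverlap {G : Type*} [Group G] [Fintype G] (lam : G → ℝ) (r : G) : ℝ :=
  ∑ f, lam f * lam (f * r)

end LocalCloning

end

/-!
The idea is to compare the entanglement before and after the cloning of a suitable superposition.
Let Alice prepare the superposition of all `ψ_f ⊗ φ`, flagged by orthogonal states of an additional
register of hers. Bob's reduced state is then the average over `f` of his reduced states of
`ψ_f ⊗ φ`. Averaging the translates of `lam` over the group gives the uniform distribution, so this
is `(1/D) 1 ⊗ φ_b`, with entropy `1 + E(φ)`. In each branch of the operation, `ψ_f ⊗ φ` becomes a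
multiple of `ψ_f ⊗ ψ_f`, by a factor whose modulus is independent of `f` (`norm_multiplier_eq`, by
comparing determinants). Hence Bob's reduced state has the eigenvalues
`(1/D) ∑ f, lam (f⁻¹ x) lam (f⁻¹ y) = q (x⁻¹ y) / D` after every branch, and its entropy is
`1 + H(q)`. Since a separable operation does not increase entanglement, `E(φ) ≥ H(q)`.

The last step is proved as a majorization statement. Truncating `φ` to some of its Schmidt vectors
costs the remaining Schmidt coefficients; the closure condition preserves this truncation error on
average over the branches (`sum_hsNormSq_kraus`), and every branch turns the truncated ket into an
approximation, of no larger Schmidt rank, of the output. By the Eckart–Young argument its error is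
at least that of a projection of the output onto a subspace of that dimension
(`exists_branch_projections`), so partial sums of the Schmidt coefficients of `φ` are bounded by
partial sums of `q` (`exists_weights_blank`). Schur concavity of the entropy
(`shannonEntropy_le_of_majorized`) then gives `H(q) ≤ E(φ)`. The flag register does not appear in
the formal argument: it amounts to summing squared Hilbert–Schmidt norms over `f`, with one
projection on Bob's side that serves all `f`.

Finally `E(ψ_f) = H(lam)`, and `q` is a mixture, with the positive weights `lam f`, of translates
of `lam`, which do not all agree because the states are not maximally entangled; strict concavity
gives `H(q) > H(lam)` (`shannonEntropy_lt_shiftOverlap`).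
-/

open scoped Matrix Kronecker

noncomputable section

namespace LocalCloning

/-! ### Shannon entropy -/

lemma shannonEntropy_eq_sum_negMulLog (D : ℕ) {I : Type*} [Fintype I] (p : I → ℝ) :
    shannonEntropy D p = (∑ r, Real.negMulLog (p r)) / Real.log D := by
  simp only [shannonEntropy, Real.logb, Real.negMulLog, Finset.sum_div, ← Finset.sum_neg_distrib]
  exact Finset.sum_congr rfl fun r _ => by ring

lemma shannonEntropy_comp_equiv (D : ℕ) {I J : Type*} [Fintype I] [Fintype J] (e : I ≃ J)
    (p : J → ℝ) : shannonEntropy D (p ∘ e) = shannonEntropy D p := by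
  simp only [shannonEntropy, Function.comp_apply]
  rw [Equiv.sum_comp e fun r => p r * Real.logb D (p r)]

lemma exists_equiv_fin_antitone {ι : Type*} [Fintype ι] {n : ℕ} (hn : Fintype.card ι = n)
    (p : ι → ℝ) : ∃ e : Fin n ≃ ι, Antitone (p ∘ e) := by
  let e₀ : Fin n ≃ ι := (Fintype.equivFinOfCardEq hn).symm
  refine ⟨(Tuple.sort fun i => -p (e₀ i)).trans e₀, fun i j hij => ?_⟩
  have := Tuple.monotone_sort (fun i => -p (e₀ i)) hij
  simpa using this

/-- Abel summation: weights that decrease give a nonnegative pairing with a sequence of total sum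
zero whose partial sums are nonnegative. -/
lemma sum_mul_nonneg_of_antitone {n : ℕ} {c d : Fin n → ℝ} (hc : Antitone c)
    (hd : ∀ k ≤ n, 0 ≤ ∑ i : Fin n, if (i : ℕ) < k then d i else 0) (hsum : ∑ i, d i = 0) :
    0 ≤ ∑ i, c i * d i := by
  let c' : ℕ → ℝ := fun i => if h : i < n then c ⟨i, h⟩ else 0
  let d' : ℕ → ℝ := fun i => if h : i < n then d ⟨i, h⟩ else 0
  have hpre : ∀ k ≤ n, 0 ≤ ∑ i ∈ Finset.range k, d' i := by
    intro k hk
    have : ∑ i ∈ Finset.range k, d' i = ∑ i : Fin n, if (i : ℕ) < k then d i else 0 := by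
      have h1 : (∑ i : Fin n, if (i : ℕ) < k then d i else 0)
          = ∑ i ∈ Finset.range n, if i < k then d' i else 0 := by
        rw [Finset.sum_range]
        simp [d']
      rw [h1, ← Finset.sum_filter]
      congr 1
      ext i
      simp only [Finset.mem_range, Finset.mem_filter]
      omega
    rw [this]
    exact hd k hk
  have htot : ∑ i ∈ Finset.range n, d' i = 0 := by
    rw [Finset.sum_range, ← hsum]
    simp [d']
  have hmain : ∑ i, c i * d i = ∑ i ∈ Finset.range n, c' i • d' i := by
    rw [Finset.sum_range]
    simp [c', d']
  rw [hmain, Finset.sum_range_by_parts, htot, smul_zero, zero_sub, neg_nonneg]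
  refine Finset.sum_nonpos fun i hi => ?_
  rw [Finset.mem_range] at hi
  refine mul_nonpos_of_nonpos_of_nonneg ?_ (hpre _ (by omega))
  simp only [c', dif_pos (show i + 1 < n by omega), dif_pos (show i < n by omega), sub_nonpos]
  exact hc (by simp)

/-- Among weights in `[0, 1]` of total at most `k`, the indicator of the `k` largest entries
maximizes the pairing with a nonnegative decreasing sequence. -/
lemma sum_mul_le_sum_first {n : ℕ} {q w : Fin n → ℝ} (hq : Antitone q) (hq0 : ∀ i, 0 ≤ q i)
    (hw0 : ∀ i, 0 ≤ w i) (hw1 : ∀ i, w i ≤ 1) {k : ℕ} (hk : k ≤ n) (hwk : ∑ i, w i ≤ k) :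
    ∑ i, q i * w i ≤ ∑ i : Fin n, if (i : ℕ) < k then q i else 0 := by
  rcases hk.eq_or_lt with rfl | hk
  · exact Finset.sum_le_sum fun i _ => by
      simpa using mul_le_mul_of_nonneg_left (hw1 i) (hq0 i)
  · set t := q ⟨k, hk⟩ with ht
    have hcount : ∑ i : Fin n, (if (i : ℕ) < k then (1 : ℝ) else 0) = k := by
      rw [Finset.sum_boole]
      have := Fin.card_filter_val_lt (n := n) (m := k)
      rw [this, min_eq_right hk.le]
    -- compare entry by entry after subtracting the threshold `t`
    have hterm : ∀ i : Fin n, (q i - t) * w i ≤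
        (q i - t) * (if (i : ℕ) < k then (1 : ℝ) else 0) := by
      intro i
      split_ifs with h
      · have : t ≤ q i := hq (by simpa [Fin.le_def] using h.le)
        exact mul_le_mul_of_nonneg_left (hw1 i) (by linarith)
      · have : q i ≤ t := hq (by simpa [Fin.le_def] using h)
        nlinarith [hw0 i]
    have hsum := Finset.sum_le_sum fun i (_ : i ∈ Finset.univ) => hterm i
    simp only [sub_mul, Finset.sum_sub_distrib, ← Finset.mul_sum, hcount] at hsum
    have : t * ∑ i, w i ≤ t * k := mul_le_mul_of_nonneg_left hwk (hq0 _)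
    simp only [mul_ite, mul_one, mul_zero] at hsum
    linarith

/-- Gibbs' inequality, termwise. -/
lemma mul_log_sub_mul_log_le {p q : ℝ} (hp : 0 < p) (hq : 0 ≤ q) :
    q * Real.log p - q * Real.log q ≤ p - q := by
  rcases hq.eq_or_lt with rfl | hq
  · simpa using hp.le
  · have h := Real.log_le_sub_one_of_pos (div_pos hp hq)
    rw [Real.log_div hp.ne' hq.ne'] at h
    have h2 := mul_le_mul_of_nonneg_left h hq.le
    have h3 : q * (p / q - 1) = p - q := by field_simp
    rw [h3] at h2
    linarith

/-- Schur concavity of the Shannon entropy. The majorization of `p` by `q` is expressed with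
weights: every partial sum of `p` over `k` indices is at most a sum of entries of `q` with weights
in `[0, 1]` of total at most `k`. -/
theorem shannonEntropy_le_of_majorized {D : ℕ} (hD : 2 ≤ D) {ι κ : Type*} [Fintype ι] [Fintype κ]
    (hcard : Fintype.card ι = Fintype.card κ) {p : ι → ℝ} {q : κ → ℝ}
    (hp : ∀ i, 0 < p i) (hq : ∀ r, 0 ≤ q r) (hpq : ∑ i, p i = ∑ r, q r)
    (hmaj : ∀ S : Finset ι, ∃ w : κ → ℝ, (∀ r, 0 ≤ w r) ∧ (∀ r, w r ≤ 1) ∧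
      ∑ r, w r ≤ S.card ∧ ∑ i ∈ S, p i ≤ ∑ r, q r * w r) :
    shannonEntropy D q ≤ shannonEntropy D p := by
  obtain ⟨n, hn⟩ : ∃ n, Fintype.card κ = n := ⟨_, rfl⟩
  obtain ⟨e, he⟩ := exists_equiv_fin_antitone (hcard.trans hn) p
  obtain ⟨e', he'⟩ := exists_equiv_fin_antitone hn q
  rw [← shannonEntropy_comp_equiv D e p, ← shannonEntropy_comp_equiv D e' q]
  have hpre : ∀ k ≤ n, 0 ≤ ∑ i : Fin n, if (i : ℕ) < k then q (e' i) - p (e i) else 0 := by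
    intro k hk
    let S : Finset ι := (Finset.univ.filter fun i : Fin n => (i : ℕ) < k).map e.toEmbedding
    have hS : S.card = k := by
      have := Fin.card_filter_val_lt (n := n) (m := k)
      rw [Finset.card_map, this, min_eq_right hk]
    obtain ⟨w, hw0, hw1, hwk, hle⟩ := hmaj S
    have h1 : ∑ i ∈ S, p i = ∑ i : Fin n, if (i : ℕ) < k then p (e i) else 0 := by
      simp [S, Finset.sum_filter]
    have h2 := sum_mul_le_sum_first (q := q ∘ e') (w := w ∘ e') he' (fun i => hq _)
      (fun i => hw0 _) (fun i => hw1 _) hk (by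
        simp only [Function.comp_apply]
        rw [Equiv.sum_comp e' w, ← hS]
        exact hwk)
    simp only [Function.comp_apply] at h2
    rw [Equiv.sum_comp e' fun r => q r * w r] at h2
    have h3 : (∑ i : Fin n, if (i : ℕ) < k then q (e' i) - p (e i) else 0)
        = (∑ i : Fin n, if (i : ℕ) < k then q (e' i) else 0)
          - ∑ i : Fin n, if (i : ℕ) < k then p (e i) else 0 := by
      rw [← Finset.sum_sub_distrib]
      exact Finset.sum_congr rfl fun i _ => by split_ifs <;> simp
    rw [h3]
    linarith
  have hzero : ∑ i, (q (e' i) - p (e i)) = 0 := by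
    rw [Finset.sum_sub_distrib, Equiv.sum_comp e' q, Equiv.sum_comp e p, hpq, sub_self]
  have habel := sum_mul_nonneg_of_antitone (c := fun i => Real.log (p (e i)))
    (fun i j hij => Real.log_le_log (hp _) (he hij)) hpre hzero
  have hgibbs := Finset.sum_le_sum fun i (_ : i ∈ Finset.univ) =>
    mul_log_sub_mul_log_le (hp (e i)) (hq (e' i))
  simp only [Finset.sum_sub_distrib, mul_sub] at hgibbs hzero habel
  rw [shannonEntropy_eq_sum_negMulLog, shannonEntropy_eq_sum_negMulLog]
  refine div_le_div_of_nonneg_right ?_ (Real.log_nonneg (by exact_mod_cast (by omega : 1 ≤ D)))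
  simp only [Real.negMulLog, Function.comp_apply, neg_mul, Finset.sum_neg_distrib]
  have hc1 : ∑ i, Real.log (p (e i)) * q (e' i) = ∑ i, q (e' i) * Real.log (p (e i)) :=
    Finset.sum_congr rfl fun i _ => mul_comm _ _
  have hc2 : ∑ i, Real.log (p (e i)) * p (e i) = ∑ i, p (e i) * Real.log (p (e i)) :=
    Finset.sum_congr rfl fun i _ => mul_comm _ _
  linarith

lemma shiftOverlap_nonneg {G : Type*} [Group G] [Fintype G] {lam : G → ℝ} (h : ∀ g, 0 ≤ lam g)
    (r : G) : 0 ≤ shiftOverlap lam r :=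
  Finset.sum_nonneg fun _ _ => mul_nonneg (h _) (h _)

lemma sum_shiftOverlap {G : Type*} [Group G] [Fintype G] (lam : G → ℝ) :
    ∑ r, shiftOverlap lam r = (∑ g, lam g) ^ 2 := by
  simp only [shiftOverlap]
  rw [Finset.sum_comm, sq, Finset.sum_mul]
  refine Finset.sum_congr rfl fun f _ => ?_
  rw [← Finset.mul_sum]
  exact congrArg (lam f * ·) (Equiv.sum_comp (Equiv.mulLeft f) lam)

/-- The distribution `q` is a mixture, with weights `lam f`, of the translates of `lam`, so strict
concavity makes its entropy larger unless all these translates agree. -/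
theorem shannonEntropy_lt_shiftOverlap {D : ℕ} (hD : 2 ≤ D) {G : Type*} [Group G] [Fintype G]
    {lam : G → ℝ} (hpos : ∀ g, 0 < lam g) (hsum : ∑ g, lam g = 1) (hne : ∃ g, lam g ≠ lam 1) :
    shannonEntropy D lam < shannonEntropy D (shiftOverlap lam) := by
  rw [shannonEntropy_eq_sum_negMulLog, shannonEntropy_eq_sum_negMulLog]
  refine div_lt_div_of_pos_right ?_ (Real.log_pos (by exact_mod_cast (by omega : 1 < D)))
  have hmix : ∑ r, Real.negMulLog (lam r) =
      ∑ r, ∑ f, lam f • Real.negMulLog (lam (f * r)) := by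
    rw [Finset.sum_comm]
    simp only [smul_eq_mul, ← Finset.mul_sum]
    have : ∀ f, ∑ r, Real.negMulLog (lam (f * r)) = ∑ r, Real.negMulLog (lam r) := fun f =>
      Equiv.sum_comp (Equiv.mulLeft f) fun r => Real.negMulLog (lam r)
    simp only [this, ← Finset.sum_mul, hsum, one_mul]
  rw [hmix]
  obtain ⟨g, hg⟩ := hne
  refine Finset.sum_lt_sum_of_nonempty Finset.univ_nonempty fun r _ => ?_
  refine Real.strictConcaveOn_negMulLog.lt_map_sum (w := lam) (p := fun f => lam (f * r))
    (fun f _ => hpos f) hsum (fun f _ => (hpos _).le) ?_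
  exact ⟨g * r⁻¹, Finset.mem_univ _, r⁻¹, Finset.mem_univ _, by simpa using hg⟩

/-! ### The Hilbert–Schmidt norm and spectral projections -/

/-- The squared Hilbert–Schmidt norm of a matrix. -/
def hsNormSq {m n : Type*} [Fintype m] [Fintype n] (X : Matrix m n ℂ) : ℝ :=
  ∑ i, ∑ j, ‖X i j‖ ^ 2

section

variable {m n : Type*} [Fintype m] [Fintype n]

lemma hsNormSq_nonneg (X : Matrix m n ℂ) : 0 ≤ hsNormSq X :=
  Finset.sum_nonneg fun _ _ => Finset.sum_nonneg fun _ _ => by positivity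

lemma ofReal_hsNormSq (X : Matrix m n ℂ) : (hsNormSq X : ℂ) = (Xᴴ * X).trace := by
  simp only [hsNormSq, Matrix.trace, Matrix.diag, Matrix.mul_apply, Matrix.conjTranspose_apply]
  rw [Finset.sum_comm]
  push_cast
  refine Finset.sum_congr rfl fun i _ => Finset.sum_congr rfl fun j _ => ?_
  rw [RCLike.star_def, RCLike.conj_mul]
  rfl

open scoped ComplexOrder in
lemma hsNormSq_eq_zero {X : Matrix m n ℂ} : hsNormSq X = 0 ↔ X = 0 := by
  rw [← Matrix.trace_conjTranspose_mul_self_eq_zero_iff, ← ofReal_hsNormSq, Complex.ofReal_eq_zero]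

lemma hsNormSq_smul (c : ℂ) (X : Matrix m n ℂ) : hsNormSq (c • X) = ‖c‖ ^ 2 * hsNormSq X := by
  simp only [hsNormSq, Matrix.smul_apply, smul_eq_mul, norm_mul, mul_pow, Finset.mul_sum]

lemma hsNormSq_kronecker {m' n' : Type*} [Fintype m'] [Fintype n'] (X : Matrix m n ℂ)
    (Y : Matrix m' n' ℂ) : hsNormSq (X ⊗ₖ Y) = hsNormSq X * hsNormSq Y := by
  have : ((hsNormSq (X ⊗ₖ Y) : ℝ) : ℂ) = ((hsNormSq X * hsNormSq Y : ℝ) : ℂ) := by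
    push_cast
    rw [ofReal_hsNormSq, ofReal_hsNormSq, ofReal_hsNormSq, Matrix.conjTranspose_kronecker,
      ← Matrix.mul_kronecker_mul, Matrix.trace_kronecker]
  exact_mod_cast this

variable [DecidableEq n]

/-- Pythagoras for a projection acting on the rows. -/
lemma hsNormSq_mul_one_sub_le {Q : Matrix n n ℂ} (hQ : Qᴴ = Q) (hQQ : Q * Q = Q)
    (X : Matrix m n ℂ) : hsNormSq (X * (1 - Q)) ≤ hsNormSq X := by
  have h : ((hsNormSq X : ℝ) : ℂ) =
      ((hsNormSq (X * Q) + hsNormSq (X * (1 - Q)) : ℝ) : ℂ) := by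
    push_cast
    simp only [ofReal_hsNormSq, Matrix.conjTranspose_mul, Matrix.conjTranspose_sub,
      Matrix.conjTranspose_one, hQ]
    have h1 : (Q * Xᴴ * (X * Q)).trace = (Q * (Xᴴ * X)).trace := by
      rw [← Matrix.mul_assoc, Matrix.trace_mul_comm, Matrix.mul_assoc Q, ← Matrix.mul_assoc Q Q,
        hQQ]
    have hQQ' : (1 - Q) * (1 - Q) = 1 - Q := by
      simp [Matrix.mul_sub, Matrix.sub_mul, hQQ]
    have h2 : ((1 - Q) * Xᴴ * (X * (1 - Q))).trace = ((1 - Q) * (Xᴴ * X)).trace := by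
      rw [← Matrix.mul_assoc, Matrix.trace_mul_comm, Matrix.mul_assoc (1 - Q),
        ← Matrix.mul_assoc (1 - Q) (1 - Q), hQQ']
    rw [h1, h2, Matrix.sub_mul, Matrix.one_mul, Matrix.trace_sub]
    ring
  have h' : hsNormSq X = hsNormSq (X * Q) + hsNormSq (X * (1 - Q)) := by exact_mod_cast h
  linarith [hsNormSq_nonneg (X * Q)]

/-- The eigenvalues of `Xᴴ * X`, that is, the squared singular values of `X`. -/
def sqSingularValues (X : Matrix m n ℂ) : n → ℝ :=
  (Matrix.isHermitian_conjTranspose_mul_self X).eigenvalues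

/-- A unitary matrix whose columns are right singular vectors of `X`. -/
def rightSingular (X : Matrix m n ℂ) : Matrix n n ℂ :=
  (Matrix.isHermitian_conjTranspose_mul_self X).eigenvectorUnitary

/-- The orthogonal projection onto the span of the right singular vectors of `X` with indices
in `S`. -/
def singularProj (X : Matrix m n ℂ) (S : Finset n) : Matrix n n ℂ :=
  rightSingular X * Matrix.diagonal (fun i => if i ∈ S then 1 else 0) * (rightSingular X)ᴴ

lemma conjTranspose_mul_rightSingular (X : Matrix m n ℂ) :
    (rightSingular X)ᴴ * rightSingular X = 1 :=
  Unitary.coe_star_mul_self (Matrix.isHermitian_conjTranspose_mul_self X).eigenvectorUnitary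

lemma rightSingular_mul_conjTranspose (X : Matrix m n ℂ) :
    rightSingular X * (rightSingular X)ᴴ = 1 :=
  Unitary.coe_mul_star_self (Matrix.isHermitian_conjTranspose_mul_self X).eigenvectorUnitary

lemma conjTranspose_mul_self_eq (X : Matrix m n ℂ) :
    Xᴴ * X = rightSingular X * Matrix.diagonal (fun i => (sqSingularValues X i : ℂ)) *
      (rightSingular X)ᴴ :=
  (Matrix.isHermitian_conjTranspose_mul_self X).spectral_theorem

lemma sum_sqSingularValues (X : Matrix m n ℂ) : ∑ i, sqSingularValues X i = hsNormSq X := by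
  have h := (Matrix.isHermitian_conjTranspose_mul_self X).trace_eq_sum_eigenvalues
  rw [← ofReal_hsNormSq] at h
  have h' : ((hsNormSq X : ℝ) : ℂ) = ((∑ i, sqSingularValues X i : ℝ) : ℂ) := by
    push_cast
    exact h
  exact_mod_cast h'.symm

lemma conjTranspose_singularProj (X : Matrix m n ℂ) (S : Finset n) :
    (singularProj X S)ᴴ = singularProj X S := by
  have : star (fun i => if i ∈ S then (1 : ℂ) else 0) = fun i => if i ∈ S then (1 : ℂ) else 0 := by
    funext i
    simp only [Pi.star_apply]
    split_ifs <;> simp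
  simp only [singularProj, Matrix.conjTranspose_mul, Matrix.conjTranspose_conjTranspose,
    Matrix.diagonal_conjTranspose, this, Matrix.mul_assoc]

lemma conj_unitary_mul {V : Matrix n n ℂ} (hV : Vᴴ * V = 1) (E F : Matrix n n ℂ) :
    (V * E * Vᴴ) * (V * F * Vᴴ) = V * (E * F) * Vᴴ := by
  calc (V * E * Vᴴ) * (V * F * Vᴴ) = V * E * (Vᴴ * V) * F * Vᴴ := by
        simp only [Matrix.mul_assoc]
    _ = V * (E * F) * Vᴴ := by rw [hV, Matrix.mul_one, Matrix.mul_assoc V E F]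

lemma singularProj_mul_self (X : Matrix m n ℂ) (S : Finset n) :
    singularProj X S * singularProj X S = singularProj X S := by
  rw [singularProj, conj_unitary_mul (conjTranspose_mul_rightSingular X),
    Matrix.diagonal_mul_diagonal]
  simp only [mul_ite, mul_one, mul_zero, ← ite_and, and_self]

lemma trace_singularProj (X : Matrix m n ℂ) (S : Finset n) :
    (singularProj X S).trace = S.card := by
  rw [singularProj, Matrix.mul_assoc, Matrix.trace_mul_comm, Matrix.mul_assoc,
    conjTranspose_mul_rightSingular, Matrix.mul_one, Matrix.trace_diagonal]
  simp

/-- Truncating the singular value decomposition of `X` to the indices in `S` costs the squared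
singular values outside `S`. -/
lemma hsNormSq_mul_one_sub_singularProj (X : Matrix m n ℂ) (S : Finset n) :
    hsNormSq (X * (1 - singularProj X S)) = ∑ i ∈ Sᶜ, sqSingularValues X i := by
  set V := rightSingular X with hV
  let E : Matrix n n ℂ := Matrix.diagonal fun i => if i ∈ S then 0 else 1
  have hE : 1 - singularProj X S = V * E * Vᴴ := by
    have : E = 1 - Matrix.diagonal (fun i => if i ∈ S then 1 else 0) := by
      rw [← Matrix.diagonal_one, Matrix.diagonal_sub]
      refine congrArg Matrix.diagonal (funext fun i => ?_)
      split_ifs <;> simp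
    rw [this, Matrix.mul_sub, Matrix.sub_mul, Matrix.mul_one, hV, rightSingular_mul_conjTranspose,
      singularProj]
  have hEH : (1 - singularProj X S)ᴴ = 1 - singularProj X S := by
    rw [Matrix.conjTranspose_sub, Matrix.conjTranspose_one, conjTranspose_singularProj]
  have h : ((hsNormSq (X * (1 - singularProj X S)) : ℝ) : ℂ) =
      ((∑ i ∈ Sᶜ, sqSingularValues X i : ℝ) : ℂ) := by
    rw [ofReal_hsNormSq, Matrix.conjTranspose_mul, hEH, Matrix.mul_assoc, ← Matrix.mul_assoc Xᴴ,
      conjTranspose_mul_self_eq, hE, ← hV, conj_unitary_mul (conjTranspose_mul_rightSingular X),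
      conj_unitary_mul (conjTranspose_mul_rightSingular X), Matrix.mul_assoc,
      Matrix.trace_mul_comm, Matrix.mul_assoc, conjTranspose_mul_rightSingular, Matrix.mul_one,
      Matrix.diagonal_mul_diagonal, Matrix.diagonal_mul_diagonal, Matrix.trace_diagonal]
    push_cast
    rw [← Finset.sum_filter_add_sum_filter_not Finset.univ (· ∈ S)]
    rw [Finset.sum_eq_zero, zero_add]
    · refine Finset.sum_congr (by ext; simp) fun i hi => ?_
      simp only [Finset.mem_compl] at hi
      simp [hi]
    · intro i hi
      simp only [Finset.mem_filter, Finset.mem_univ, true_and] at hi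
      simp [hi]
  exact_mod_cast h

lemma rank_one_kronecker_singularProj_le (κ : Type*) [Fintype κ] [DecidableEq κ]
    (X : Matrix m n ℂ) (S : Finset n) :
    ((1 : Matrix κ κ ℂ) ⊗ₖ singularProj X S).rank ≤ Fintype.card κ * S.card := by
  have h : (1 : Matrix κ κ ℂ) ⊗ₖ singularProj X S =
      ((1 : Matrix κ κ ℂ) ⊗ₖ rightSingular X) *
        (Matrix.diagonal fun p : κ × n => if p.2 ∈ S then (1 : ℂ) else 0) *
        ((1 : Matrix κ κ ℂ) ⊗ₖ (rightSingular X)ᴴ) := by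
    have hd : (Matrix.diagonal fun p : κ × n => if p.2 ∈ S then (1 : ℂ) else 0) =
        (1 : Matrix κ κ ℂ) ⊗ₖ Matrix.diagonal (fun i : n => if i ∈ S then (1 : ℂ) else 0) := by
      rw [← Matrix.diagonal_one, Matrix.diagonal_kronecker_diagonal]
      simp
    rw [hd, ← Matrix.mul_kronecker_mul, ← Matrix.mul_kronecker_mul]
    simp [singularProj]
  rw [h]
  refine (Matrix.rank_mul_le_left _ _).trans ((Matrix.rank_mul_le_right _ _).trans ?_)
  rw [Matrix.rank_diagonal, Fintype.card_subtype, ← Finset.card_univ, ← Finset.card_product]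
  refine Finset.card_le_card fun p hp => ?_
  simpa using hp

open scoped ComplexOrder in
/-- The orthogonal projection onto the row space of a matrix. -/
lemma exists_rowSpace_projection (W : Matrix m n ℂ) :
    ∃ Q : Matrix n n ℂ, Qᴴ = Q ∧ Q * Q = Q ∧ W * Q = W ∧ Q.trace = W.rank := by
  let S : Finset n := Finset.univ.filter fun i => sqSingularValues W i ≠ 0
  refine ⟨singularProj W S, conjTranspose_singularProj W S, singularProj_mul_self W S, ?_, ?_⟩
  · have h : hsNormSq (W * (1 - singularProj W S)) = 0 := by
      rw [hsNormSq_mul_one_sub_singularProj]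
      refine Finset.sum_eq_zero fun i hi => ?_
      simpa [S] using hi
    rw [hsNormSq_eq_zero, Matrix.mul_sub, Matrix.mul_one, sub_eq_zero] at h
    exact h.symm
  · rw [trace_singularProj, ← Matrix.rank_conjTranspose_mul_self,
      (Matrix.isHermitian_conjTranspose_mul_self W).rank_eq_card_non_zero_eigs,
      Fintype.card_subtype]
    rfl

end

/-! ### Separable operations on families of pure states -/

/-- On amplitude matrices the product Kraus operator `K ⊗ L` acts as `X ↦ K X Lᵀ`; the closure
condition says that these maps jointly preserve the Hilbert–Schmidt norm. -/
lemma sum_hsNormSq_kraus {m n : Type*} [Fintype m] [Fintype n] [DecidableEq m] [DecidableEq n]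
    {M : ℕ} {K : Fin M → Matrix m m ℂ} {L : Fin M → Matrix n n ℂ}
    (hKL : ∑ k, ((K k)ᴴ * K k) ⊗ₖ ((L k)ᴴ * L k) = (1 : Matrix m m ℂ) ⊗ₖ (1 : Matrix n n ℂ))
    (X : Matrix m n ℂ) : ∑ k, hsNormSq (K k * X * (L k)ᵀ) = hsNormSq X := by
  have hvec : ∀ Y : Matrix m n ℂ, ((hsNormSq Y : ℝ) : ℂ) = star (Yᵀ.vec) ⬝ᵥ Yᵀ.vec := by
    intro Y
    simp only [hsNormSq, dotProduct, Fintype.sum_prod_type, Matrix.vec, Pi.star_apply]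
    push_cast
    refine Finset.sum_congr rfl fun i _ => Finset.sum_congr rfl fun j _ => ?_
    rw [RCLike.star_def, RCLike.conj_mul]
    rfl
  have hk : ∀ k, ((hsNormSq (K k * X * (L k)ᵀ) : ℝ) : ℂ) =
      star (Xᵀ.vec) ⬝ᵥ ((((K k)ᴴ * K k) ⊗ₖ ((L k)ᴴ * L k)) *ᵥ Xᵀ.vec) := by
    intro k
    have h1 : (K k * X * (L k)ᵀ)ᵀ.vec = (K k ⊗ₖ L k) *ᵥ Xᵀ.vec := by
      rw [Matrix.kronecker_mulVec_vec]
      simp [Matrix.mul_assoc]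
    rw [hvec, h1, Matrix.mul_kronecker_mul, ← Matrix.conjTranspose_kronecker, Matrix.star_mulVec,
      ← Matrix.mulVec_mulVec, Matrix.dotProduct_mulVec (star Xᵀ.vec)]
  have h : ((∑ k, hsNormSq (K k * X * (L k)ᵀ) : ℝ) : ℂ) = ((hsNormSq X : ℝ) : ℂ) := by
    push_cast
    simp only [hk]
    rw [← dotProduct_sum, ← Matrix.sum_mulVec, hKL, Matrix.one_kronecker_one, Matrix.one_mulVec,
      ← hvec]
  exact_mod_cast h

/-- If the Kraus operators jointly send a ket to a pure state, each of them sends it to a multiple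
of that state, and the squared moduli of the multipliers are outcome probabilities. -/
lemma exists_kraus_multiplier {I : Type*} [Fintype I] [DecidableEq I] {M : ℕ}
    {T : Fin M → Matrix I I ℂ} {χ η : EuclideanSpace ℂ I} (hη : ‖η‖ = 1)
    (h : ∑ k, T k * proj χ * (T k)ᴴ = proj η) :
    ∃ c : Fin M → ℂ, ∑ k, ‖c k‖ ^ 2 = 1 ∧ ∀ k i, (T k *ᵥ χ) i = c k * η i := by
  let u : Fin M → EuclideanSpace ℂ I := fun k => WithLp.toLp 2 (T k *ᵥ χ)
  have hu : ∀ i j, ∑ k, u k i * star (u k j) = η i * star (η j) := by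
    intro i j
    have hij := congrFun (congrFun h i) j
    rw [Matrix.sum_apply] at hij
    rw [show η i * star (η j) = proj η i j from rfl, ← hij]
    refine Finset.sum_congr rfl fun k _ => ?_
    have hp : proj χ = Matrix.vecMulVec χ (star χ) := rfl
    rw [hp, Matrix.mul_vecMulVec, Matrix.vecMulVec_mul, ← Matrix.star_mulVec]
    rfl
  have hη2 : ∑ i, ‖η i‖ ^ 2 = 1 := by
    rw [← EuclideanSpace.norm_sq_eq, hη, one_pow]
  have hηc : ∑ i, η i * star (η i) = 1 := by
    have : ((∑ i, ‖η i‖ ^ 2 : ℝ) : ℂ) = 1 := by rw [hη2]; simp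
    rw [← this]
    push_cast
    refine Finset.sum_congr rfl fun i _ => ?_
    rw [RCLike.star_def, RCLike.mul_conj]
    rfl
  let c : Fin M → ℂ := fun k => inner ℂ η (u k)
  have hnorm : ∀ k, ‖u k - c k • η‖ ^ 2 = ‖u k‖ ^ 2 - ‖c k‖ ^ 2 := by
    intro k
    have h1 : inner ℂ (u k) (c k • η) = ((‖c k‖ ^ 2 : ℝ) : ℂ) := by
      rw [inner_smul_right, ← inner_conj_symm (u k) η, RCLike.mul_conj]
      simp [c]
    rw [@norm_sub_sq ℂ, h1, norm_smul, hη]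
    simp only [Complex.ofReal_re, RCLike.re_to_complex]
    ring
  have hsum_u : ∑ k, ‖u k‖ ^ 2 = 1 := by
    have h1 : ((∑ k, ‖u k‖ ^ 2 : ℝ) : ℂ) = 1 := by
      simp only [EuclideanSpace.norm_sq_eq]
      rw [Finset.sum_comm, ← hηc]
      push_cast
      refine Finset.sum_congr rfl fun i _ => ?_
      rw [← hu]
      refine Finset.sum_congr rfl fun k _ => ?_
      rw [RCLike.star_def, RCLike.mul_conj]
      rfl
    exact_mod_cast h1
  have hsum_c : ∑ k, ‖c k‖ ^ 2 = 1 := by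
    have h1 : ((∑ k, ‖c k‖ ^ 2 : ℝ) : ℂ) = 1 := by
      calc ((∑ k, ‖c k‖ ^ 2 : ℝ) : ℂ) = ∑ k, c k * star (c k) := by
            push_cast
            refine Finset.sum_congr rfl fun k _ => ?_
            rw [RCLike.star_def, RCLike.mul_conj]
            rfl
        _ = ∑ k, ∑ i, ∑ j, star (η i) * η j * (u k i * star (u k j)) := by
            refine Finset.sum_congr rfl fun k _ => ?_
            have hc : c k = ∑ i, star (η i) * u k i := by
              simp [c, PiLp.inner_apply, mul_comm]
            rw [hc, star_sum, Finset.sum_mul_sum]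
            refine Finset.sum_congr rfl fun i _ => Finset.sum_congr rfl fun j _ => ?_
            simp only [star_mul', star_star]
            ring
        _ = ∑ i, ∑ j, star (η i) * η j * (η i * star (η j)) := by
            rw [Finset.sum_comm]
            refine Finset.sum_congr rfl fun i _ => ?_
            rw [Finset.sum_comm]
            refine Finset.sum_congr rfl fun j _ => ?_
            rw [← Finset.mul_sum, hu]
        _ = (∑ i, η i * star (η i)) * ∑ j, η j * star (η j) := by
            rw [Finset.sum_mul_sum]
            refine Finset.sum_congr rfl fun i _ => Finset.sum_congr rfl fun j _ => by ring
        _ = 1 := by rw [hηc, one_mul]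
    exact_mod_cast h1
  refine ⟨c, hsum_c, fun k i => ?_⟩
  have hz : ∑ k, ‖u k - c k • η‖ ^ 2 = 0 := by
    simp only [hnorm, Finset.sum_sub_distrib, hsum_u, hsum_c, sub_self]
  rw [Finset.sum_eq_zero_iff_of_nonneg fun _ _ => by positivity] at hz
  have hk : u k = c k • η := by
    have := hz k (Finset.mem_univ k)
    rwa [sq_eq_zero_iff, norm_eq_zero, sub_eq_zero] at this
  have := congrArg (fun v : EuclideanSpace ℂ I => v i) hk
  simpa [u] using this

/-- Monotonicity of truncation errors under separable operations. If every `X f` is sent to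
multiples of `Y f`, then truncating all the `X f` on the right by one and the same matrix `R`
yields, in each branch `k`, approximations of the multiples of `Y f` with rows in one common space
of dimension at most the rank of `R`; the error of these approximations is at least that of the
orthogonal projection `Q k` onto this space. -/
theorem exists_branch_projections {G m n : Type*} [Fintype G] [Fintype m] [Fintype n]
    [DecidableEq m] [DecidableEq n] {M : ℕ}
    {K : Fin M → Matrix m m ℂ} {L : Fin M → Matrix n n ℂ}
    (hKL : ∑ k, ((K k)ᴴ * K k) ⊗ₖ ((L k)ᴴ * L k) = (1 : Matrix m m ℂ) ⊗ₖ (1 : Matrix n n ℂ))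
    {X Y : G → Matrix m n ℂ} {c : G → Fin M → ℂ}
    (hXY : ∀ f k, K k * X f * (L k)ᵀ = c f k • Y f) (R : Matrix n n ℂ) :
    ∃ Q : Fin M → Matrix n n ℂ, (∀ k, (Q k)ᴴ = Q k) ∧ (∀ k, Q k * Q k = Q k) ∧
      (∀ k, (Q k).trace.re ≤ R.rank) ∧
      ∑ k, ∑ f, ‖c f k‖ ^ 2 * hsNormSq (Y f * (1 - Q k)) ≤ ∑ f, hsNormSq (X f * (1 - R)) := by
  choose Q hQ hQQ hW htr using fun k => exists_rowSpace_projection (R * (L k)ᵀ)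
  refine ⟨Q, hQ, hQQ, fun k => ?_, ?_⟩
  · rw [htr k]
    simpa using Matrix.rank_mul_le_left R (L k)ᵀ
  · have hbranch : ∀ f k, ‖c f k‖ ^ 2 * hsNormSq (Y f * (1 - Q k)) ≤
        hsNormSq (K k * (X f * (1 - R)) * (L k)ᵀ) := by
      intro f k
      have h1 : (c f k • Y f) * (1 - Q k) = (K k * (X f * (1 - R)) * (L k)ᵀ) * (1 - Q k) := by
        rw [← hXY]
        have h2 : R * (L k)ᵀ * (1 - Q k) = 0 := by
          rw [Matrix.mul_sub, Matrix.mul_one, hW, sub_self]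
        have h3 : K k * (X f * (1 - R)) * (L k)ᵀ * (1 - Q k) =
            K k * X f * (L k)ᵀ * (1 - Q k) - K k * X f * (R * (L k)ᵀ * (1 - Q k)) := by
          simp only [Matrix.mul_sub, Matrix.sub_mul, Matrix.mul_assoc, Matrix.mul_one]
          abel
        rw [h3, h2, Matrix.mul_zero, sub_zero]
      rw [← hsNormSq_smul, ← Matrix.smul_mul, h1]
      exact hsNormSq_mul_one_sub_le (hQ k) (hQQ k) _
    rw [Finset.sum_comm]
    refine Finset.sum_le_sum fun f _ => ?_
    rw [← sum_hsNormSq_kraus hKL (X f * (1 - R))]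
    exact Finset.sum_le_sum fun k _ => hbranch f k

/-- The diagonal entries of a projection in an orthonormal basis are weights in `[0, 1]`, and they
determine the error of the projection on a family whose Gram operator is diagonal in this basis. -/
lemma exists_diagonal_weights {G n κ l : Type*} [Fintype G] [Fintype n] [Fintype κ]
    [Fintype l] [DecidableEq n] [DecidableEq κ] {Q : Matrix n n ℂ} (hQ : Qᴴ = Q) (hQQ : Q * Q = Q)
    {W : Matrix n κ ℂ} (hW : Wᴴ * W = 1) (hW' : W * Wᴴ = 1)
    {Y : G → Matrix l n ℂ} {d : κ → ℝ}
    (hY : ∑ f, (Y f)ᴴ * Y f = W * Matrix.diagonal (fun x => (d x : ℂ)) * Wᴴ) :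
    ∃ w : κ → ℝ, (∀ x, 0 ≤ w x) ∧ (∀ x, w x ≤ 1) ∧ ∑ x, w x = Q.trace.re ∧
      ∑ f, hsNormSq (Y f * (1 - Q)) = ∑ x, d x * (1 - w x) := by
  have hdiag : ∀ P : Matrix n n ℂ, Pᴴ = P → P * P = P → ∀ x,
      (Wᴴ * P * W) x x = ((∑ i, ‖(P * W) i x‖ ^ 2 : ℝ) : ℂ) := by
    intro P hP hPP x
    have : Wᴴ * P * W = (P * W)ᴴ * (P * W) := by
      rw [Matrix.conjTranspose_mul, hP, Matrix.mul_assoc Wᴴ P (P * W), ← Matrix.mul_assoc P P,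
        hPP, Matrix.mul_assoc]
    rw [this, Matrix.mul_apply]
    push_cast
    refine Finset.sum_congr rfl fun i _ => ?_
    rw [Matrix.conjTranspose_apply, RCLike.star_def, RCLike.conj_mul]
    rfl
  have hQ' : (1 - Q)ᴴ = 1 - Q := by
    rw [Matrix.conjTranspose_sub, Matrix.conjTranspose_one, hQ]
  have hQQ' : (1 - Q) * (1 - Q) = 1 - Q := by
    simp [Matrix.mul_sub, Matrix.sub_mul, hQQ]
  let w : κ → ℝ := fun x => ∑ i, ‖(Q * W) i x‖ ^ 2
  let w' : κ → ℝ := fun x => ∑ i, ‖((1 - Q) * W : Matrix n κ ℂ) i x‖ ^ 2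
  have hww' : ∀ x, w' x = 1 - w x := by
    intro x
    have h : ((w' x : ℝ) : ℂ) = ((1 - w x : ℝ) : ℂ) := by
      push_cast
      rw [← hdiag Q hQ hQQ x, ← hdiag (1 - Q) hQ' hQQ' x, Matrix.mul_sub, Matrix.sub_mul,
        Matrix.mul_one, hW]
      simp
    exact_mod_cast h
  have hw0 : ∀ x, 0 ≤ w x := fun x => Finset.sum_nonneg fun _ _ => by positivity
  have hw0' : ∀ x, 0 ≤ w' x := fun x => Finset.sum_nonneg fun _ _ => by positivity
  refine ⟨w, hw0, fun x => by linarith [hww' x, hw0' x], ?_, ?_⟩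
  · have h : ((∑ x, w x : ℝ) : ℂ) = Q.trace := by
      push_cast
      simp only [w, ← hdiag Q hQ hQQ]
      change (Wᴴ * Q * W).trace = _
      rw [Matrix.trace_mul_comm, ← Matrix.mul_assoc, hW', Matrix.one_mul]
    rw [← h, Complex.ofReal_re]
  · have h : ((∑ f, hsNormSq (Y f * (1 - Q)) : ℝ) : ℂ) = ((∑ x, d x * (1 - w x) : ℝ) : ℂ) := by
      have h1 : ∀ f, ((hsNormSq (Y f * (1 - Q)) : ℝ) : ℂ) =
          ((1 - Q) * ((Y f)ᴴ * Y f)).trace := by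
        intro f
        rw [ofReal_hsNormSq, Matrix.conjTranspose_mul, hQ', ← Matrix.mul_assoc,
          Matrix.trace_mul_comm, Matrix.mul_assoc (1 - Q), ← Matrix.mul_assoc (1 - Q) (1 - Q),
          hQQ']
      push_cast
      simp only [h1]
      rw [← Matrix.trace_sum, ← Matrix.mul_sum, hY, ← Matrix.mul_assoc, Matrix.trace_mul_comm,
        ← Matrix.mul_assoc, ← Matrix.mul_assoc]
      simp only [Matrix.trace, Matrix.diag, Matrix.mul_diagonal]
      refine Finset.sum_congr rfl fun x _ => ?_
      rw [hdiag (1 - Q) hQ' hQQ' x]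
      change ((w' x : ℝ) : ℂ) * _ = _
      rw [hww']
      push_cast
      ring
    exact_mod_cast h

/-! ### Schmidt coefficients -/

lemma norm_sq_eq_hsNormSq {m n : Type*} [Fintype m] [Fintype n] (χ : BiKet m n) :
    ‖χ‖ ^ 2 = hsNormSq (coeffMatrix χ) := by
  rw [EuclideanSpace.norm_sq_eq, Fintype.sum_prod_type]
  rfl

lemma coeffMatrix_jointKet {A B a b : Type*} (χ : BiKet A B) (η : BiKet a b) :
    coeffMatrix (jointKet χ η) = coeffMatrix χ ⊗ₖ coeffMatrix η := rfl

lemma coeffMatrix_kronecker_mulVec {m n : Type*} [Fintype m] [Fintype n] (K : Matrix m m ℂ)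
    (L : Matrix n n ℂ) (χ : BiKet m n) (i : m) (j : n) :
    ((K ⊗ₖ L) *ᵥ χ) (i, j) = (K * coeffMatrix χ * Lᵀ) i j := by
  have h : (χ : m × n → ℂ) = ((coeffMatrix χ)ᵀ).vec := rfl
  have h2 : L * (coeffMatrix χ)ᵀ * Kᵀ = (K * coeffMatrix χ * Lᵀ)ᵀ := by
    simp [Matrix.mul_assoc]
  rw [h, Matrix.kronecker_mulVec_vec, h2]
  rfl

lemma map_schmidtCoeff_eq {D : ℕ} {ι : Type*} [Fintype ι] {χ : BiKet (Fin D) (Fin D)}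
    {ν : ι → ℝ} (h : (coeffMatrix χ * (coeffMatrix χ)ᴴ).charpoly =
      ∏ i, (Polynomial.X - Polynomial.C (ν i : ℂ))) :
    Finset.univ.val.map (schmidtCoeff χ) = Finset.univ.val.map ν := by
  have h1 := (Matrix.isHermitian_mul_conjTranspose_self
    (coeffMatrix χ)).roots_charpoly_eq_eigenvalues
  have h2 : (∏ i, (Polynomial.X - Polynomial.C (ν i : ℂ))).roots =
      Finset.univ.val.map fun i => (ν i : ℂ) := by
    have := Polynomial.roots_multiset_prod_X_sub_C (Finset.univ.val.map fun i => (ν i : ℂ))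
    rwa [Multiset.map_map] at this
  rw [h, h2] at h1
  refine Multiset.map_injective Complex.ofReal_injective ?_
  rw [Multiset.map_map, Multiset.map_map]
  exact h1.symm

lemma map_schmidtCoeff_eq_sqSingularValues {D : ℕ} (χ : BiKet (Fin D) (Fin D)) :
    Finset.univ.val.map (schmidtCoeff χ) =
      Finset.univ.val.map (sqSingularValues (coeffMatrix χ)) := by
  refine map_schmidtCoeff_eq ?_
  rw [Matrix.charpoly_mul_comm]
  exact (Matrix.isHermitian_conjTranspose_mul_self (coeffMatrix χ)).charpoly_eq

lemma shannonEntropy_congr (D : ℕ) {I J : Type*} [Fintype I] [Fintype J] {p : I → ℝ} {q : J → ℝ}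
    (h : Finset.univ.val.map p = Finset.univ.val.map q) :
    shannonEntropy D p = shannonEntropy D q := by
  have := congrArg (fun s : Multiset ℝ => (s.map fun x => x * Real.logb D x).sum) h
  simp only [Multiset.map_map] at this
  exact congrArg Neg.neg this

/-! ### Group-shifted kets -/

section

variable {D : ℕ} {G : Type*} [Fintype G]

/-- The matrix whose columns are the vectors of an orthonormal basis. -/
def basisMatrix (a : OrthonormalBasis G ℂ (EuclideanSpace ℂ (Fin D))) : Matrix (Fin D) G ℂ :=
  Matrix.of fun i g => a g i

lemma conjTranspose_basisMatrix_mul_self [DecidableEq G]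
    (a : OrthonormalBasis G ℂ (EuclideanSpace ℂ (Fin D))) :
    (basisMatrix a)ᴴ * basisMatrix a = 1 := by
  ext g h
  have := (orthonormal_iff_ite.mp a.orthonormal) g h
  rw [PiLp.inner_apply] at this
  rw [Matrix.mul_apply, Matrix.one_apply, ← this]
  refine Finset.sum_congr rfl fun i _ => ?_
  simp [basisMatrix, mul_comm]

lemma card_eq_of_orthonormalBasis (a : OrthonormalBasis G ℂ (EuclideanSpace ℂ (Fin D))) :
    Fintype.card G = D := by
  rw [← Module.finrank_eq_card_basis a.toBasis, finrank_euclideanSpace_fin]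

/-- Bob's basis enters the amplitude matrices without complex conjugation, so the unitary that
diagonalizes his reduced states has the conjugated basis vectors as columns. -/
def conjBasisMatrix (b : OrthonormalBasis G ℂ (EuclideanSpace ℂ (Fin D))) : Matrix (Fin D) G ℂ :=
  (basisMatrix b)ᴴᵀ

lemma conjTranspose_conjBasisMatrix_mul_self [DecidableEq G]
    (b : OrthonormalBasis G ℂ (EuclideanSpace ℂ (Fin D))) :
    (conjBasisMatrix b)ᴴ * conjBasisMatrix b = 1 := by
  have h := congrArg Matrix.transpose (conjTranspose_basisMatrix_mul_self b)
  rw [Matrix.transpose_mul, Matrix.transpose_one] at h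
  rw [← h]
  simp only [conjBasisMatrix, Matrix.conjTranspose, Matrix.transpose_transpose, Matrix.map_map,
    Matrix.transpose_map]
  congr 1
  ext i j
  simp

lemma mul_conjTranspose_conjBasisMatrix
    (b : OrthonormalBasis G ℂ (EuclideanSpace ℂ (Fin D))) :
    conjBasisMatrix b * (conjBasisMatrix b)ᴴ = 1 := by
  classical
  exact (Matrix.mul_eq_one_comm_of_card_eq _ _ _
    (by rw [Fintype.card_fin, card_eq_of_orthonormalBasis b])).mpr
    (conjTranspose_conjBasisMatrix_mul_self b)

variable [Group G] (a b : OrthonormalBasis G ℂ (EuclideanSpace ℂ (Fin D))) {lam : G → ℝ}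
  (θ : G → G → ℝ)

lemma coeffMatrix_groupShifted [DecidableEq G] (lam : G → ℝ) (f : G) :
    coeffMatrix (groupShifted a b lam θ f) = basisMatrix a *
      Matrix.diagonal (fun g => (Real.sqrt (lam g) : ℂ) * Complex.exp (Complex.I * (θ f g : ℂ))) *
      ((conjBasisMatrix b).submatrix id (f * ·))ᴴ := by
  ext i j
  simp only [coeffMatrix, groupShifted, Matrix.of_apply, Matrix.mul_apply (N := _ᴴ), Matrix.mul_diagonal]
  simp only [WithLp.ofLp_sum, Finset.sum_apply, PiLp.smul_apply, smul_eq_mul]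
  refine Finset.sum_congr rfl fun g _ => ?_
  simp [prodKet, basisMatrix, conjBasisMatrix]
  ring

lemma star_mul_phase {x t : ℝ} (hx : 0 ≤ x) :
    star ((Real.sqrt x : ℂ) * Complex.exp (Complex.I * (t : ℂ))) *
      ((Real.sqrt x : ℂ) * Complex.exp (Complex.I * (t : ℂ))) = (x : ℂ) := by
  rw [RCLike.star_def, RCLike.conj_mul, norm_mul, mul_comm Complex.I, Complex.norm_exp_ofReal_mul_I,
    Complex.norm_real, mul_one, Real.norm_of_nonneg (Real.sqrt_nonneg _)]
  change ((Real.sqrt x : ℝ) : ℂ) ^ 2 = (x : ℂ)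
  rw [← Complex.ofReal_pow, Real.sq_sqrt hx]

lemma groupShifted_mul_conjTranspose [DecidableEq G] (hlam : ∀ g, 0 ≤ lam g) (f : G) :
    coeffMatrix (groupShifted a b lam θ f) * (coeffMatrix (groupShifted a b lam θ f))ᴴ =
      basisMatrix a * Matrix.diagonal (fun g => (lam g : ℂ)) * (basisMatrix a)ᴴ := by
  have hB : ((conjBasisMatrix b).submatrix id (f * ·))ᴴ *
      (conjBasisMatrix b).submatrix id (f * ·) = 1 := by
    have h : ((conjBasisMatrix b).submatrix id (f * ·))ᴴ *
        (conjBasisMatrix b).submatrix id (f * ·) =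
        ((conjBasisMatrix b)ᴴ * conjBasisMatrix b).submatrix (f * ·) (f * ·) := rfl
    rw [h, conjTranspose_conjBasisMatrix_mul_self]
    exact Matrix.submatrix_one_equiv (Equiv.mulLeft f)
  rw [coeffMatrix_groupShifted]
  set s : G → ℂ :=
    fun g => (Real.sqrt (lam g) : ℂ) * Complex.exp (Complex.I * (θ f g : ℂ)) with hs
  have hss : Matrix.diagonal s * Matrix.diagonal (star s) =
      Matrix.diagonal fun g => (lam g : ℂ) := by
    rw [Matrix.diagonal_mul_diagonal]
    refine congrArg Matrix.diagonal (funext fun g => ?_)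
    rw [mul_comm]
    exact star_mul_phase (hlam g)
  rw [← hss]
  simp only [Matrix.conjTranspose_mul, Matrix.conjTranspose_conjTranspose,
    Matrix.diagonal_conjTranspose, Matrix.mul_assoc]
  rw [← Matrix.mul_assoc (_ᴴ) ((conjBasisMatrix b).submatrix id (f * ·)), hB, Matrix.one_mul]

/-- Up to conjugation, Bob's reduced state of `ψ_f` is diagonal in his basis, with the distribution
`lam` translated by `f`. -/
lemma conjTranspose_mul_groupShifted [DecidableEq G] (hlam : ∀ g, 0 ≤ lam g) (f : G) :
    (coeffMatrix (groupShifted a b lam θ f))ᴴ * coeffMatrix (groupShifted a b lam θ f) =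
      conjBasisMatrix b * Matrix.diagonal (fun x => (lam (f⁻¹ * x) : ℂ)) *
        (conjBasisMatrix b)ᴴ := by
  have hB : (conjBasisMatrix b).submatrix id (f * ·) * Matrix.diagonal (fun g => (lam g : ℂ)) *
      ((conjBasisMatrix b).submatrix id (f * ·))ᴴ =
      conjBasisMatrix b * Matrix.diagonal (fun x => (lam (f⁻¹ * x) : ℂ)) *
        (conjBasisMatrix b)ᴴ := by
    ext i j
    simp only [Matrix.mul_apply (N := _ᴴ), Matrix.mul_diagonal]
    rw [← Equiv.sum_comp (Equiv.mulLeft f) fun x => conjBasisMatrix b i x *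
      (lam (f⁻¹ * x) : ℂ) * (conjBasisMatrix b)ᴴ x j]
    simp
  rw [← hB, coeffMatrix_groupShifted]
  set s : G → ℂ :=
    fun g => (Real.sqrt (lam g) : ℂ) * Complex.exp (Complex.I * (θ f g : ℂ)) with hs
  have hss : Matrix.diagonal (star s) * Matrix.diagonal s =
      Matrix.diagonal fun g => (lam g : ℂ) := by
    rw [Matrix.diagonal_mul_diagonal]
    exact congrArg Matrix.diagonal (funext fun g => star_mul_phase (hlam g))
  rw [← hss]
  simp only [Matrix.conjTranspose_mul, Matrix.conjTranspose_conjTranspose,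
    Matrix.diagonal_conjTranspose, Matrix.mul_assoc]
  rw [← Matrix.mul_assoc (_ᴴ) (basisMatrix a), conjTranspose_basisMatrix_mul_self, Matrix.one_mul]

lemma map_schmidtCoeff_groupShifted (hlam : ∀ g, 0 ≤ lam g) (f : G) :
    Finset.univ.val.map (schmidtCoeff (groupShifted a b lam θ f)) = Finset.univ.val.map lam := by
  classical
  refine map_schmidtCoeff_eq ?_
  rw [groupShifted_mul_conjTranspose a b θ hlam, ← Matrix.charpoly_diagonal]
  have h := Matrix.charpoly_mul_comm' (basisMatrix a * Matrix.diagonal (fun g => (lam g : ℂ)))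
    (basisMatrix a)ᴴ
  rw [← Matrix.mul_assoc (_ᴴ), conjTranspose_basisMatrix_mul_self, Matrix.one_mul,
    card_eq_of_orthonormalBasis a, Fintype.card_fin] at h
  exact mul_left_cancel₀ (pow_ne_zero _ Polynomial.X_ne_zero) h

lemma hsNormSq_groupShifted (hlam : ∀ g, 0 ≤ lam g) (f : G) :
    hsNormSq (coeffMatrix (groupShifted a b lam θ f)) = ∑ g, lam g := by
  rw [← sum_sqSingularValues]
  have h := congrArg Multiset.sum ((map_schmidtCoeff_eq_sqSingularValues _).symm.trans
    (map_schmidtCoeff_groupShifted a b θ hlam f))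
  exact h

lemma norm_det_groupShifted_sq (hlam : ∀ g, 0 ≤ lam g) (f : G) :
    ‖(coeffMatrix (groupShifted a b lam θ f)).det‖ ^ 2 = ∏ g, lam g := by
  set X := coeffMatrix (groupShifted a b lam θ f) with hX
  have h := congrArg Multiset.prod (map_schmidtCoeff_groupShifted a b θ hlam f)
  have h' : ∏ i, schmidtCoeff (groupShifted a b lam θ f) i = ∏ g, lam g := h
  have h1 := (Matrix.isHermitian_mul_conjTranspose_self X).det_eq_prod_eigenvalues
  rw [Matrix.det_mul, Matrix.det_conjTranspose, RCLike.star_def, RCLike.mul_conj] at h1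
  have h2 : ((‖X.det‖ ^ 2 : ℝ) : ℂ) = ((∏ g, lam g : ℝ) : ℂ) := by
    rw [← h']
    push_cast
    exact h1
  exact_mod_cast h2

/-- The joint spectrum on Bob's side after cloning: averaging the products of two copies of the
translates of `lam` over the group leaves a function of `x⁻¹ * y` only. -/
lemma sum_conjTranspose_mul_kronecker_groupShifted [DecidableEq G] (hlam : ∀ g, 0 ≤ lam g) :
    ∑ f, (coeffMatrix (groupShifted a b lam θ f) ⊗ₖ coeffMatrix (groupShifted a b lam θ f))ᴴ *
        (coeffMatrix (groupShifted a b lam θ f) ⊗ₖ coeffMatrix (groupShifted a b lam θ f)) =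
      (conjBasisMatrix b ⊗ₖ conjBasisMatrix b) *
        Matrix.diagonal (fun p : G × G => (shiftOverlap lam (p.1⁻¹ * p.2) : ℂ)) *
        (conjBasisMatrix b ⊗ₖ conjBasisMatrix b)ᴴ := by
  have hq : (Matrix.diagonal fun p : G × G => (shiftOverlap lam (p.1⁻¹ * p.2) : ℂ)) =
      ∑ f, Matrix.diagonal (fun x => (lam (f⁻¹ * x) : ℂ)) ⊗ₖ
        Matrix.diagonal (fun x => (lam (f⁻¹ * x) : ℂ)) := by
    simp only [Matrix.diagonal_kronecker_diagonal]
    ext p p'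
    rw [Matrix.sum_apply]
    by_cases hp : p = p'
    · subst hp
      simp only [Matrix.diagonal_apply_eq, shiftOverlap]
      rw [← Equiv.sum_comp ((Equiv.inv G).trans (Equiv.mulRight p.1))]
      push_cast
      refine Finset.sum_congr rfl fun f _ => ?_
      simp [mul_assoc]
    · simp [Matrix.diagonal_apply_ne _ hp]
  rw [hq, Matrix.mul_sum, Matrix.sum_mul]
  refine Finset.sum_congr rfl fun f _ => ?_
  rw [Matrix.conjTranspose_kronecker, ← Matrix.mul_kronecker_mul,
    conjTranspose_mul_groupShifted a b θ hlam, Matrix.mul_kronecker_mul, Matrix.mul_kronecker_mul,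
    Matrix.conjTranspose_kronecker]

end

/-! ### Cloning of group-shifted kets -/

section

variable {D : ℕ} {G : Type*} [Group G] [Fintype G]
  (a b : OrthonormalBasis G ℂ (EuclideanSpace ℂ (Fin D))) {lam : G → ℝ} (θ : G → G → ℝ)

/-- Local cloning in terms of amplitude matrices. -/
lemma exists_kraus_of_locallyCloneable (hlam : ∀ g, 0 ≤ lam g) (hsum : ∑ g, lam g = 1)
    {φ : BiKet (Fin D) (Fin D)} (clone : LocallyCloneable (groupShifted a b lam θ) φ) :
    ∃ (M : ℕ) (K L : Fin M → Matrix (Fin D × Fin D) (Fin D × Fin D) ℂ) (c : G → Fin M → ℂ),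
      (∑ k, ((K k)ᴴ * K k) ⊗ₖ ((L k)ᴴ * L k) =
        (1 : Matrix (Fin D × Fin D) (Fin D × Fin D) ℂ) ⊗ₖ 1) ∧
      (∀ f, ∑ k, ‖c f k‖ ^ 2 = 1) ∧
      ∀ f k, K k * (coeffMatrix (groupShifted a b lam θ f) ⊗ₖ coeffMatrix φ) * (L k)ᵀ =
        c f k • (coeffMatrix (groupShifted a b lam θ f) ⊗ₖ
          coeffMatrix (groupShifted a b lam θ f)) := by
  obtain ⟨Λ, ⟨M, K, L, hKL, hΛ⟩, hclone⟩ := clone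
  have hex : ∀ f, ∃ c : Fin M → ℂ, ∑ k, ‖c k‖ ^ 2 = 1 ∧
      ∀ k i, ((K k ⊗ₖ L k) *ᵥ jointKet (groupShifted a b lam θ f) φ) i =
        c k * jointKet (groupShifted a b lam θ f) (groupShifted a b lam θ f) i := by
    intro f
    refine exists_kraus_multiplier ?_ ((hΛ _).symm.trans (hclone f))
    have h : ‖jointKet (groupShifted a b lam θ f) (groupShifted a b lam θ f)‖ ^ 2 = 1 := by
      rw [norm_sq_eq_hsNormSq, coeffMatrix_jointKet, hsNormSq_kronecker,
        hsNormSq_groupShifted a b θ hlam, hsum, one_mul]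
    exact (pow_eq_one_iff_of_nonneg (norm_nonneg _) two_ne_zero).mp h
  choose c hc hcK using hex
  refine ⟨M, K, L, c, hKL, hc, fun f k => ?_⟩
  ext i j
  rw [← coeffMatrix_jointKet, ← coeffMatrix_kronecker_mulVec, hcK]
  rfl

variable {θ} {φ : BiKet (Fin D) (Fin D)} {M : ℕ}
  {K L : Fin M → Matrix (Fin D × Fin D) (Fin D × Fin D) ℂ} {c : G → Fin M → ℂ}

lemma norm_det_cloning
    (hker : ∀ f k, K k * (coeffMatrix (groupShifted a b lam θ f) ⊗ₖ coeffMatrix φ) * (L k)ᵀ =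
      c f k • (coeffMatrix (groupShifted a b lam θ f) ⊗ₖ
        coeffMatrix (groupShifted a b lam θ f))) (f : G) (k : Fin M) :
    ‖(K k).det‖ * (‖(coeffMatrix (groupShifted a b lam θ f)).det‖ ^ D *
        ‖(coeffMatrix φ).det‖ ^ D) * ‖(L k).det‖ =
      ‖c f k‖ ^ (D * D) * (‖(coeffMatrix (groupShifted a b lam θ f)).det‖ ^ D *
        ‖(coeffMatrix (groupShifted a b lam θ f)).det‖ ^ D) := by
  have h := congrArg (fun X => ‖Matrix.det X‖) (hker f k)
  simpa [Matrix.det_mul, Matrix.det_kronecker, Matrix.det_smul, norm_mul, norm_pow] using h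

/-- The outcome probabilities do not depend on which of the states is cloned: compare
determinants, whose modulus is the same for all group-shifted kets. -/
lemma norm_multiplier_eq (hpos : ∀ g, 0 < lam g)
    (hker : ∀ f k, K k * (coeffMatrix (groupShifted a b lam θ f) ⊗ₖ coeffMatrix φ) * (L k)ᵀ =
      c f k • (coeffMatrix (groupShifted a b lam θ f) ⊗ₖ
        coeffMatrix (groupShifted a b lam θ f))) (f : G) (k : Fin M) :
    ‖c f k‖ = ‖c 1 k‖ := by
  have hD : D ≠ 0 := by
    rw [← card_eq_of_orthonormalBasis a]
    exact Fintype.card_ne_zero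
  have hdet : ∀ f, ‖(coeffMatrix (groupShifted a b lam θ f)).det‖ = Real.sqrt (∏ g, lam g) := by
    intro f
    rw [← norm_det_groupShifted_sq a b θ (fun g => (hpos g).le) f, Real.sqrt_sq (norm_nonneg _)]
  have hne : Real.sqrt (∏ g, lam g) ≠ 0 :=
    (Real.sqrt_pos.mpr (Finset.prod_pos fun g _ => hpos g)).ne'
  have h := norm_det_cloning a b hker f k
  have h1 := norm_det_cloning a b hker 1 k
  rw [hdet] at h h1
  rw [h] at h1
  have h2 := mul_right_cancel₀ (mul_ne_zero (pow_ne_zero _ hne) (pow_ne_zero _ hne)) h1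
  exact (pow_left_inj₀ (norm_nonneg _) (norm_nonneg _) (mul_ne_zero hD hD)).mp h2

/-- The blank state has full Schmidt rank. -/
lemma det_blank_ne_zero (hpos : ∀ g, 0 < lam g) (hc : ∀ f, ∑ k, ‖c f k‖ ^ 2 = 1)
    (hker : ∀ f k, K k * (coeffMatrix (groupShifted a b lam θ f) ⊗ₖ coeffMatrix φ) * (L k)ᵀ =
      c f k • (coeffMatrix (groupShifted a b lam θ f) ⊗ₖ
        coeffMatrix (groupShifted a b lam θ f))) :
    (coeffMatrix φ).det ≠ 0 := by
  have hD : D ≠ 0 := by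
    rw [← card_eq_of_orthonormalBasis a]
    exact Fintype.card_ne_zero
  intro h0
  have hψ : ‖(coeffMatrix (groupShifted a b lam θ 1)).det‖ ≠ 0 := by
    intro h
    have := norm_det_groupShifted_sq a b θ (fun g => (hpos g).le) 1
    rw [h] at this
    exact (Finset.prod_pos fun g _ => hpos g).ne (by simpa using this)
  have hc0 : ∀ k, ‖c 1 k‖ ^ 2 = 0 := by
    intro k
    have h := norm_det_cloning a b hker 1 k
    rw [h0, norm_zero, zero_pow hD, mul_zero, mul_zero, zero_mul, eq_comm, mul_eq_zero,
      or_iff_left (mul_ne_zero (pow_ne_zero _ hψ) (pow_ne_zero _ hψ)), pow_eq_zero_iff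
      (mul_ne_zero hD hD)] at h
    rw [h, sq, mul_zero]
  have := hc 1
  simp [hc0] at this

lemma sum_sum_mul_right {α : Type*} [AddCommMonoid α] (F : G × G → α) :
    ∑ p, F p = ∑ r, ∑ x, F (x, x * r) := by
  rw [Finset.sum_comm, Fintype.sum_prod_type]
  refine Finset.sum_congr rfl fun x _ => ?_
  exact (Equiv.sum_comp (Equiv.mulLeft x) fun y => F (x, y)).symm

/-- The distribution `q` majorizes the Schmidt coefficients of the blank state. This is the
truncation estimate for the superposition of all `ψ_f ⊗ φ`, flagged by orthogonal states on
Alice's side: Bob's reduced state is `1/D` times the identity, tensored with that of `φ`, before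
the cloning, and has eigenvalues `q (x⁻¹ * y) / D` after it. -/
theorem exists_weights_blank (hpos : ∀ g, 0 < lam g) (hsum : ∑ g, lam g = 1) (norm_φ : ‖φ‖ = 1)
    (hKL : ∑ k, ((K k)ᴴ * K k) ⊗ₖ ((L k)ᴴ * L k) =
      (1 : Matrix (Fin D × Fin D) (Fin D × Fin D) ℂ) ⊗ₖ 1)
    (hc : ∀ f, ∑ k, ‖c f k‖ ^ 2 = 1)
    (hker : ∀ f k, K k * (coeffMatrix (groupShifted a b lam θ f) ⊗ₖ coeffMatrix φ) * (L k)ᵀ =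
      c f k • (coeffMatrix (groupShifted a b lam θ f) ⊗ₖ
        coeffMatrix (groupShifted a b lam θ f))) (S : Finset (Fin D)) :
    ∃ w : G → ℝ, (∀ r, 0 ≤ w r) ∧ (∀ r, w r ≤ 1) ∧ ∑ r, w r ≤ S.card ∧
      ∑ i ∈ S, sqSingularValues (coeffMatrix φ) i ≤ ∑ r, shiftOverlap lam r * w r := by
  classical
  have hlam : ∀ g, 0 ≤ lam g := fun g => (hpos g).le
  have hcard := card_eq_of_orthonormalBasis a
  have hD : 0 < (D : ℝ) := by
    rw [← hcard]
    exact_mod_cast Fintype.card_pos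
  set Φ := coeffMatrix φ with hΦ
  set P := singularProj Φ S with hP
  obtain ⟨Q, hQ, hQQ, htr, hle⟩ :=
    exists_branch_projections hKL hker ((1 : Matrix (Fin D) (Fin D) ℂ) ⊗ₖ P)
  have hW : (conjBasisMatrix b ⊗ₖ conjBasisMatrix b)ᴴ *
      (conjBasisMatrix b ⊗ₖ conjBasisMatrix b) = 1 := by
    rw [Matrix.conjTranspose_kronecker, ← Matrix.mul_kronecker_mul,
      conjTranspose_conjBasisMatrix_mul_self, Matrix.one_kronecker_one]
  have hW' : (conjBasisMatrix b ⊗ₖ conjBasisMatrix b) *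
      (conjBasisMatrix b ⊗ₖ conjBasisMatrix b)ᴴ = 1 := by
    rw [Matrix.conjTranspose_kronecker, ← Matrix.mul_kronecker_mul,
      mul_conjTranspose_conjBasisMatrix, Matrix.one_kronecker_one]
  choose v hv0 hv1 hvtr hv using fun k => exists_diagonal_weights (hQ k) (hQQ k) hW hW'
    (sum_conjTranspose_mul_kronecker_groupShifted a b θ hlam)
  have hvle : ∀ k, ∑ x, v k x ≤ D * S.card := by
    intro k
    rw [hvtr]
    refine (htr k).trans ?_
    have := rank_one_kronecker_singularProj_le (Fin D) Φ S
    rw [Fintype.card_fin] at this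
    exact_mod_cast this
  -- the truncation error before the cloning
  have hright : ∑ f, hsNormSq ((coeffMatrix (groupShifted a b lam θ f) ⊗ₖ Φ) *
      (1 - (1 : Matrix (Fin D) (Fin D) ℂ) ⊗ₖ P)) =
      D * (1 - ∑ i ∈ S, sqSingularValues Φ i) := by
    have htail : hsNormSq (Φ * (1 - P)) = 1 - ∑ i ∈ S, sqSingularValues Φ i := by
      rw [hP, hsNormSq_mul_one_sub_singularProj, eq_sub_iff_add_eq, Finset.sum_compl_add_sum,
        sum_sqSingularValues, hΦ, ← norm_sq_eq_hsNormSq, norm_φ, one_pow]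
    have hone : (1 : Matrix (Fin D × Fin D) (Fin D × Fin D) ℂ) -
        (1 : Matrix (Fin D) (Fin D) ℂ) ⊗ₖ P = (1 : Matrix (Fin D) (Fin D) ℂ) ⊗ₖ (1 - P) := by
      rw [sub_eq_iff_eq_add, ← Matrix.kronecker_add, sub_add_cancel, Matrix.one_kronecker_one]
    have hterm : ∀ f, hsNormSq ((coeffMatrix (groupShifted a b lam θ f) ⊗ₖ Φ) *
        (1 - (1 : Matrix (Fin D) (Fin D) ℂ) ⊗ₖ P)) = 1 - ∑ i ∈ S, sqSingularValues Φ i := by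
      intro f
      rw [hone, ← Matrix.mul_kronecker_mul, Matrix.mul_one, hsNormSq_kronecker,
        hsNormSq_groupShifted a b θ hlam, hsum, one_mul, htail]
    rw [Finset.sum_congr rfl fun f _ => hterm f, Finset.sum_const, Finset.card_univ, hcard,
      nsmul_eq_mul]
  set p : Fin M → ℝ := fun k => ‖c 1 k‖ ^ 2 with hp
  have hp0 : ∀ k, 0 ≤ p k := fun k => by positivity
  have hp1 : ∑ k, p k = 1 := hc 1
  -- average the diagonal entries over the branches and over the pairs with the same quotient
  let w : G → ℝ := fun r => (∑ k, p k * ∑ x, v k (x, x * r)) / D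
  have hqtot : ∑ z : G × G, shiftOverlap lam (z.1⁻¹ * z.2) = D := by
    rw [sum_sum_mul_right fun z : G × G => shiftOverlap lam (z.1⁻¹ * z.2)]
    simp [← Finset.mul_sum, sum_shiftOverlap, hsum, hcard]
  have hqw : ∀ k, ∑ z : G × G, shiftOverlap lam (z.1⁻¹ * z.2) * v k z =
      ∑ r, shiftOverlap lam r * ∑ x, v k (x, x * r) := by
    intro k
    rw [sum_sum_mul_right fun z : G × G => shiftOverlap lam (z.1⁻¹ * z.2) * v k z]
    simp [← Finset.mul_sum]
  refine ⟨w, fun r => ?_, fun r => ?_, ?_, ?_⟩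
  · exact div_nonneg (Finset.sum_nonneg fun k _ => mul_nonneg (hp0 k)
      (Finset.sum_nonneg fun x _ => hv0 k _)) hD.le
  · rw [div_le_one hD]
    calc ∑ k, p k * ∑ x, v k (x, x * r) ≤ ∑ k, p k * D := by
          refine Finset.sum_le_sum fun k _ => mul_le_mul_of_nonneg_left ?_ (hp0 k)
          refine (Finset.sum_le_sum fun x _ => hv1 k (x, x * r)).trans ?_
          simp [hcard]
      _ = D := by rw [← Finset.sum_mul, hp1, one_mul]
  · rw [← Finset.sum_div, div_le_iff₀ hD, Finset.sum_comm]
    calc ∑ k, ∑ r, p k * ∑ x, v k (x, x * r) = ∑ k, p k * ∑ z, v k z := by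
          refine Finset.sum_congr rfl fun k _ => ?_
          rw [← Finset.mul_sum, sum_sum_mul_right]
      _ ≤ ∑ k, p k * (D * S.card) :=
          Finset.sum_le_sum fun k _ => mul_le_mul_of_nonneg_left (hvle k) (hp0 k)
      _ = S.card * D := by rw [← Finset.sum_mul, hp1, one_mul, mul_comm]
  · have hleft : ∑ k, ∑ f, ‖c f k‖ ^ 2 *
        hsNormSq ((coeffMatrix (groupShifted a b lam θ f) ⊗ₖ
          coeffMatrix (groupShifted a b lam θ f)) * (1 - Q k)) =
        D - D * ∑ r, shiftOverlap lam r * w r := by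
      have hk : ∀ k, ∑ f, ‖c f k‖ ^ 2 *
          hsNormSq ((coeffMatrix (groupShifted a b lam θ f) ⊗ₖ
            coeffMatrix (groupShifted a b lam θ f)) * (1 - Q k)) =
          p k * D - p k * ∑ r, shiftOverlap lam r * ∑ x, v k (x, x * r) := by
        intro k
        simp only [norm_multiplier_eq a b hpos hker _ k]
        rw [← Finset.mul_sum, hv k]
        simp only [mul_sub, mul_one, Finset.sum_sub_distrib, hqtot, hqw]
        rfl
      have hswap : D * ∑ r, shiftOverlap lam r * w r =
          ∑ k, p k * ∑ r, shiftOverlap lam r * ∑ x, v k (x, x * r) := by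
        simp only [w, Finset.mul_sum, Finset.sum_div]
        rw [Finset.sum_comm]
        refine Finset.sum_congr rfl fun k _ => Finset.sum_congr rfl fun r _ =>
          Finset.sum_congr rfl fun x _ => ?_
        field_simp
      rw [Finset.sum_congr rfl fun k _ => hk k, Finset.sum_sub_distrib, hswap, ← Finset.sum_mul,
        hp1, one_mul]
    rw [hleft, hright] at hle
    have : D * ∑ i ∈ S, sqSingularValues Φ i ≤ D * ∑ r, shiftOverlap lam r * w r := by linarith
    exact le_of_mul_le_mul_left this hD

end

end LocalCloning

end

theorem theorem12 {D : ℕ} {G : Type*} [Group G] [Fintype G]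
    (a b : OrthonormalBasis G ℂ (EuclideanSpace ℂ (Fin D)))
    (lam : G → ℝ) (lam_nonneg : ∀ g, 0 ≤ lam g) (lam_sum : ∑ g, lam g = 1)
    (θ : G → G → ℝ)
    (full_rank : ∀ f, LocalCloning.schmidtRank (LocalCloning.groupShifted a b lam θ f) = D)
    (not_max : ∀ f, ¬ LocalCloning.IsMaximallyEntangled (LocalCloning.groupShifted a b lam θ f))
    (φ : LocalCloning.BiKet (Fin D) (Fin D)) (norm_φ : ‖φ‖ = 1)
    (clone : LocalCloning.LocallyCloneable (LocalCloning.groupShifted a b lam θ) φ) :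
    (∀ r, 0 ≤ LocalCloning.shiftOverlap lam r) ∧
    ∑ r, LocalCloning.shiftOverlap lam r = 1 ∧
    LocalCloning.entanglementEntropy φ ≥
      LocalCloning.shannonEntropy D (LocalCloning.shiftOverlap lam) ∧
    ∀ f, LocalCloning.shannonEntropy D (LocalCloning.shiftOverlap lam) >
        LocalCloning.entanglementEntropy (LocalCloning.groupShifted a b lam θ f) ∧
      LocalCloning.entanglementEntropy φ >
        LocalCloning.entanglementEntropy (LocalCloning.groupShifted a b lam θ f) := by
  open LocalCloning in
  have hcard := card_eq_of_orthonormalBasis a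
  have hmap := map_schmidtCoeff_groupShifted a b θ lam_nonneg
  have hpos : ∀ g, 0 < lam g := by
    have hall : ∀ r, schmidtCoeff (groupShifted a b lam θ 1) r ≠ 0 := by
      have h := full_rank 1
      rw [schmidtRank, Nat.card_eq_fintype_card] at h
      by_contra! hcon
      obtain ⟨r, hr⟩ := hcon
      have := Fintype.card_subtype_lt
        (p := fun r => schmidtCoeff (groupShifted a b lam θ 1) r ≠ 0) (x := r) (by simpa using hr)
      rw [Fintype.card_fin] at this
      exact this.ne h
    intro g
    refine lt_of_le_of_ne (lam_nonneg g) (Ne.symm ?_)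
    have hg : lam g ∈ Finset.univ.val.map lam := Multiset.mem_map_of_mem lam (Finset.mem_univ g)
    rw [← hmap 1] at hg
    obtain ⟨r, -, hr⟩ := Multiset.mem_map.mp hg
    exact hr ▸ hall r
  have hne : ∃ g, lam g ≠ lam 1 := by
    by_contra! hcon
    have hone : ∀ g, lam g = 1 / (D : ℝ) := by
      have h := lam_sum
      simp only [hcon, Finset.sum_const, Finset.card_univ, hcard, nsmul_eq_mul] at h
      intro g
      rw [hcon g]
      exact eq_one_div_of_mul_eq_one_right h
    refine not_max 1 fun r => ?_
    have hr : schmidtCoeff (groupShifted a b lam θ 1) r ∈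
        Finset.univ.val.map (schmidtCoeff (groupShifted a b lam θ 1)) :=
      Multiset.mem_map_of_mem _ (Finset.mem_univ r)
    rw [hmap 1] at hr
    obtain ⟨g, -, hg⟩ := Multiset.mem_map.mp hr
    rw [← hg, hone]
  have hD : 2 ≤ D := by
    obtain ⟨g, hg⟩ := hne
    rw [← hcard]
    exact Fintype.one_lt_card_iff.mpr ⟨g, 1, fun h => hg (by rw [h])⟩
  have hqsum : ∑ r, shiftOverlap lam r = 1 := by rw [sum_shiftOverlap, lam_sum, one_pow]
  obtain ⟨M, K, L, c, hKL, hc, hker⟩ :=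
    exists_kraus_of_locallyCloneable a b θ lam_nonneg lam_sum clone
  have hsv : ∀ i, 0 < sqSingularValues (coeffMatrix φ) i := by
    intro i
    refine lt_of_le_of_ne (Matrix.eigenvalues_conjTranspose_mul_self_nonneg _ i) (Ne.symm ?_)
    have hdet := det_blank_ne_zero a b hpos hc hker
    have hprod := (Matrix.isHermitian_conjTranspose_mul_self
      (coeffMatrix φ)).det_eq_prod_eigenvalues
    rw [Matrix.det_mul, Matrix.det_conjTranspose] at hprod
    have hprod_ne := mul_ne_zero (star_ne_zero.mpr hdet) hdet
    rw [hprod] at hprod_ne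
    have := Finset.prod_ne_zero_iff.mp hprod_ne i (Finset.mem_univ i)
    exact fun h0 => this (congrArg Complex.ofReal h0)
  have hblank : shannonEntropy D (shiftOverlap lam) ≤ entanglementEntropy φ := by
    rw [entanglementEntropy, shannonEntropy_congr D (map_schmidtCoeff_eq_sqSingularValues φ)]
    refine shannonEntropy_le_of_majorized hD (by rw [Fintype.card_fin, hcard]) hsv
      (shiftOverlap_nonneg lam_nonneg) ?_
      (exists_weights_blank a b hpos lam_sum norm_φ hKL hc hker)
    rw [sum_sqSingularValues, ← norm_sq_eq_hsNormSq, norm_φ, one_pow, hqsum]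
  have hshift : ∀ f, entanglementEntropy (groupShifted a b lam θ f) <
      shannonEntropy D (shiftOverlap lam) := by
    intro f
    rw [entanglementEntropy, shannonEntropy_congr D (hmap f)]
    exact shannonEntropy_lt_shiftOverlap hD hpos lam_sum hne
  exact ⟨shiftOverlap_nonneg lam_nonneg, hqsum, hblank, fun f =>
    ⟨hshift f, (hshift f).trans_le hblank⟩⟩
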